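/- Let $M$ be a lattice of rank $n$ in an $n$-dimensional real vector space $M_{\mathbb R}=M\otimes\mathbb R$, and let $\langle\cdot,\cdot\rangle$ be the pairing between $M_{\mathbb R}$ and its dual $N_{\mathbb R}=(M_{\mathbb R})^*$. Let $\Box\subset M_{\mathbb R}$ be an $n$-dimensional simple convex lattice polytope, that is, a bounded intersection of finitely many affine half-spaces which affinely spans $M_{\mathbb R}$, whose set of extreme points $\operatorname{ext}\Box$ is contained in $M$, and such that for every $\alpha\in\operatorname{ext}\Box$ the tangent cone $C_\alpha=\{r(v-\alpha): r\ge 0,\ v\in\Box\}$ is simplicial (generated by linearly independent vectors). Let $\lambda_\alpha^1,\dots,\lambda_\alpha^n$ be the primitive generators of $C_\alpha$ in $M$, i.e. the linearly independent generators of $C_\alpha$ each of which is the shortest nonzero element of $M$ on its ray, and let $$Q_\alpha=\Big\{\sum_{i=1}^n a_i\lambda_\alpha^i:\ 0\le a_i<1\Big\}.$$ Let $\mathcal T_k(x_1,\dots,x_n)$ be the Todd polynomials, defined by the formal power series identity $$\sum_{k\ge 0}s^k\,\mathcal T_k(x_1,\dots,x_n)=\prod_{i=1}^n\frac{s x_i}{1-\exp(-s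 x_i)}.$$ Then for every $\zeta\in N_{\mathbb R}$ that is generic, i.e. $\langle\zeta,\lambda_\alpha^i\rangle\ne 0$ for all $\alpha\in\operatorname{ext}\Box$ and all $i$, the number of lattice points in $\Box$ is $$\#(\Box\cap M)=\sum_{\alpha\in\operatorname{ext}\Box}\frac{1}{\prod_{i=1}^n\langle\zeta,\lambda_\alpha^i\rangle}\sum_{j=0}^n\frac{(-1)^j}{j!}\sum_{q\in Q_\alpha\cap M}\langle\zeta,\alpha+q\rangle^j\,\mathcal T_{n-j}\big(\langle\zeta,\lambda_\alpha^1\rangle,\dots,\langle\zeta,\lambda_\alpha^n\rangle\big).$$ -/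

import Mathlib

open scoped Nat

noncomputable section

namespace LatticePolytope

/-- A convex polytope: a bounded intersection of finitely many affine half-spaces. -/
def IsConvexPolytope {V : Type*} [NormedAddCommGroup V] [NormedSpace ℝ V] (P : Set V) : Prop :=
  Bornology.IsBounded P ∧
    ∃ H : Finset (Module.Dual ℝ V × ℝ),
      (∀ h ∈ H, h.1 ≠ 0) ∧ P = {v : V | ∀ h ∈ H, h.2 ≤ h.1 v}

/-- The tangent cone `ℝ≥0 (P - α)` of `P` at `α`. -/
def tangentCone {V : Type*} [AddCommGroup V] [Module ℝ V] (P : Set V) (α : V) : Set V :=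
  {x : V | ∃ r : ℝ, 0 ≤ r ∧ ∃ v ∈ P, x = r • (v - α)}

/-- A simplicial cone: one that is generated by linearly independent vectors. -/
def IsSimplicialCone {V : Type*} [AddCommGroup V] [Module ℝ V] (C : Set V) : Prop :=
  ∃ (k : ℕ) (v : Fin k → V), LinearIndependent ℝ v ∧
    C = (PointedCone.hull ℝ (Set.range v) : Set V)

/-- A full-dimensional simple convex polytope whose extreme points belong to the lattice `M`. -/
structure IsSimpleLatticePolytope {V : Type*} [NormedAddCommGroup V] [NormedSpace ℝ V]
    (M : Submodule ℤ V) (P : Set V) : Prop where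
  polytope : IsConvexPolytope P
  full_dim : affineSpan ℝ P = ⊤
  lattice : ∀ α ∈ P.extremePoints ℝ, α ∈ M
  simple : ∀ α ∈ P.extremePoints ℝ, IsSimplicialCone (tangentCone P α)

/-- `v` is the shortest nonzero element of `M` on the ray that it spans. -/
def IsPrimitive {V : Type*} [AddCommGroup V] [Module ℝ V] (M : Submodule ℤ V) (v : V) : Prop :=
  v ∈ M ∧ v ≠ 0 ∧ ∀ r : ℝ, 0 < r → r • v ∈ M → 1 ≤ r

/-- `l` lists the primitive generators in `M` of the simplicial cone `C`
(they are unique up to their order). -/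
structure IsPrimitiveGenerators {V : Type*} [AddCommGroup V] [Module ℝ V] (M : Submodule ℤ V)
    (C : Set V) {n : ℕ} (l : Fin n → V) : Prop where
  linearIndependent : LinearIndependent ℝ l
  generates : C = (PointedCone.hull ℝ (Set.range l) : Set V)
  primitive : ∀ i, IsPrimitive M (l i)

/-- The semi-open unit parallelepiped spanned by `l`. -/
def parallelepiped {V : Type*} [AddCommGroup V] [Module ℝ V] {n : ℕ} (l : Fin n → V) : Set V :=
  {x : V | ∃ a : Fin n → ℝ, (∀ i, 0 ≤ a i ∧ a i < 1) ∧ x = ∑ i, a i • l i}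

/-- The formal power series `X / (1 - exp (-X))`, written as the inverse of
`(1 - exp (-X)) / X = ∑ m, (-1) ^ m / (m + 1)! * X ^ m`. -/
def toddSeries : PowerSeries ℚ :=
  (PowerSeries.mk fun m : ℕ => (-1 : ℚ) ^ m / ((m + 1)! : ℚ))⁻¹

theorem toddSeries_mul :
    toddSeries * (1 - PowerSeries.evalNegHom (PowerSeries.exp ℚ)) = PowerSeries.X := by
  have h : (1 - PowerSeries.evalNegHom (PowerSeries.exp ℚ) : PowerSeries ℚ) =
      (PowerSeries.mk fun m : ℕ => (-1 : ℚ) ^ m / ((m + 1)! : ℚ)) * PowerSeries.X := by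
    ext k
    cases k with
    | zero =>
      rw [map_sub, PowerSeries.evalNegHom, PowerSeries.coeff_rescale]
      simp
    | succ k =>
      simp [PowerSeries.evalNegHom, PowerSeries.coeff_succ_mul_X, PowerSeries.coeff_rescale,
        PowerSeries.coeff_exp, PowerSeries.coeff_one, pow_succ, div_eq_mul_inv]
  rw [h, ← mul_assoc, toddSeries, PowerSeries.inv_mul_cancel _ (by simp), one_mul]

/-- The Todd polynomial `𝒯 k` in the variables `x i`, `i : Fin n`: the coefficient of `s ^ k` in
the formal power series `∏ i, (s * x i) / (1 - exp (-(s * x i)))` in `s`. -/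
def toddPolynomial (n k : ℕ) : MvPolynomial (Fin n) ℚ :=
  PowerSeries.coeff k
    (∏ i : Fin n, PowerSeries.rescale (MvPolynomial.X i : MvPolynomial (Fin n) ℚ)
      (PowerSeries.map (MvPolynomial.C : ℚ →+* MvPolynomial (Fin n) ℚ) toddSeries))

end LatticePolytope

end

/-! ### Edges of a simple polytope and the bases at their two ends. -/

namespace LatticePolytope

open Module

variable {V : Type*} [NormedAddCommGroup V] [NormedSpace ℝ V] {n : ℕ} {P : Set V}
  {b : V → Basis (Fin n) ℝ V}

/-! The formula compares two expressions for the sum of `exp (-ζ m X)` over the lattice points `m`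
of `P`.

First, `P` is cut into cones. At each vertex, flip the generators of the tangent cone on which `ζ`
is negative, with a sign for each flip and the matching facets removed. These signed half-open cones
add up to the indicator of `P` (`IsSimpleWithBases.sum_flippedCone`). At a point of `P` only the
cone at the `ζ`-minimal vertex contributes (`IsSimpleWithBases.existsUnique_min`). At a point
outside `P`, move `ζ` to a form separating the point from `P`, for which every term vanishes. The
sum does not change on the way: at a wall the jumps at the two ends of an edge cancel
(`IsSimpleWithBases.sum_flippedCone_eq_of_sign_eq`), because the remaining generators at the two
ends correspond (`Adjacent.exists_perm`).

Second, each cone is summed. However it is flipped, the cone at `α` with generators `λ i` has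
generating function `∑ q, exp (-ζ (α + q) X) / ∏ i, (1 - exp (-ζ (λ i) X))`
(`hasGenFun_flippedCone`). No convergence is involved: `HasGenFun` applies difference operators
until the support is finite and records the corresponding denominators. The result is well defined
and additive (`HasGenFun.unique`, `HasGenFun.sum`). Writing each denominator through the Todd series
produces a pole of order `n`; after multiplication by `X ^ n`, the coefficient of `X ^ n` is the
number of lattice points on one side and the sum over vertices on the other. -/

theorem repr_eq_sum_repr (b b' : Basis (Fin n) ℝ V) (v : V) (k : Fin n) :
    b.repr v k = ∑ m, b'.repr v m * b.repr (b' m) k := by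
  conv_lhs => rw [← b'.sum_repr v]
  simp only [map_sum, map_smul, Finsupp.coe_finsetSum, Finset.sum_apply, Finsupp.smul_apply,
    smul_eq_mul]

/-- `P` is a compact convex set with finitely many extreme points, and at each extreme point `α`
the basis `b α` generates the tangent cone of `P`. -/
structure IsSimpleWithBases (P : Set V) (b : V → Basis (Fin n) ℝ V) : Prop where
  compact : IsCompact P
  convex : Convex ℝ P
  nonempty : P.Nonempty
  finite : (P.extremePoints ℝ).Finite
  repr_nonneg : ∀ α ∈ P.extremePoints ℝ, ∀ v ∈ P, ∀ i, 0 ≤ (b α).repr (v - α) i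
  exists_edge : ∀ α ∈ P.extremePoints ℝ, ∀ i, ∃ ε : ℝ, 0 < ε ∧ α + ε • b α i ∈ P

/-- The edges of `P` leaving `α` in direction `i` and leaving `β` in direction `j` coincide. -/
def Adjacent (P : Set V) (b : V → Basis (Fin n) ℝ V) (x y : V × Fin n) : Prop :=
  x.1 ∈ P.extremePoints ℝ ∧ y.1 ∈ P.extremePoints ℝ ∧
    (∃ T : ℝ, 0 < T ∧ y.1 = x.1 + T • b x.1 x.2) ∧ ∃ c : ℝ, 0 < c ∧ b y.1 y.2 = -(c • b x.1 x.2)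

theorem Adjacent.symm {x y : V × Fin n} (h : Adjacent P b x y) : Adjacent P b y x := by
  obtain ⟨hx, hy, ⟨T, hT, hxy⟩, c, hc, hb⟩ := h
  refine ⟨hy, hx, ⟨T / c, by positivity, ?_⟩, c⁻¹, by positivity, ?_⟩
  · rw [hb, hxy, smul_neg, smul_smul, div_mul_cancel₀ _ hc.ne']
    abel
  · rw [hb, smul_neg, smul_smul, inv_mul_cancel₀ hc.ne', one_smul, neg_neg]

theorem Adjacent.ne {x y : V × Fin n} (h : Adjacent P b x y) : y ≠ x := by
  obtain ⟨hx, hy, ⟨T, hT, hxy⟩, -⟩ := h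
  rintro rfl
  have : T • b y.1 y.2 = 0 := by simpa using hxy
  exact (smul_ne_zero hT.ne' ((b y.1).ne_zero _)) this

/-- Two extreme points on a ray issuing from a point of the set coincide. -/
theorem eq_of_mem_extremePoints_ray {α u : V} (hα : α ∈ P) {S T : ℝ} (hS : 0 < S) (hT : 0 < T)
    (h₁ : α + S • u ∈ P.extremePoints ℝ) (h₂ : α + T • u ∈ P.extremePoints ℝ) :
    α + S • u = α + T • u := by
  wlog h : S ≤ T generalizing S T
  · exact (this hT hS h₂ h₁ (le_of_not_ge h)).symm
  rcases h.eq_or_lt with rfl | h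
  · rfl
  have := (mem_extremePoints.1 h₁).2 α hα _ h₂.1 ⟨1 - S / T, S / T, by
    rw [sub_pos, div_lt_one hT]; exact h, by positivity, by ring, by
    rw [smul_add, smul_smul, div_mul_cancel₀ _ hT.ne', ← add_assoc, ← add_smul]; simp⟩
  exact this.2.symm

theorem Adjacent.unique {x y z : V × Fin n} (h : Adjacent P b x y) (h' : Adjacent P b x z) :
    y = z := by
  obtain ⟨hx, hy, ⟨T, hT, hxy⟩, c, hc, hb⟩ := h
  obtain ⟨-, hz, ⟨S, hS, hxz⟩, d, hd, hb'⟩ := h'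
  have h1 : y.1 = z.1 := by
    rw [hxy, hxz]
    exact eq_of_mem_extremePoints_ray hx.1 hT hS (hxy ▸ hy) (hxz ▸ hz)
  refine Prod.ext h1 ?_
  by_contra hne
  rw [← h1] at hb'
  have h2 : d • b y.1 y.2 = c • b y.1 z.2 := by
    rw [hb, hb', smul_neg, smul_neg, smul_smul, smul_smul, mul_comm]
  have h3 := congrArg (fun v => (b y.1).repr v y.2) h2
  simp [hd.ne', Ne.symm hne] at h3

/-- A short step from `y.1` along its `m`-th generator stays in `P`, hence in the cone at `x.1`; the
edge from `x.1` to `y.1` contributes nothing to the `k`-th coordinate. -/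
theorem Adjacent.repr_nonneg (h : IsSimpleWithBases P b) {x y : V × Fin n} (hxy : Adjacent P b x y)
    {k : Fin n} (hk : k ≠ x.2) (m : Fin n) : 0 ≤ (b x.1).repr (b y.1 m) k := by
  obtain ⟨hx, hy, ⟨T, hT, e⟩, -⟩ := hxy
  obtain ⟨ε, hε, hm⟩ := h.exists_edge _ hy m
  have h1 := h.repr_nonneg _ hx _ hm k
  rw [e, show x.1 + T • b x.1 x.2 + ε • b (x.1 + T • b x.1 x.2) m - x.1 =
    T • b x.1 x.2 + ε • b (x.1 + T • b x.1 x.2) m by abel, ← e] at h1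
  simp [Ne.symm hk] at h1
  exact nonneg_of_mul_nonneg_right h1 hε

/-- By compactness there is a last point `β` of `P` on the ray from `α` along `u`, and the
coordinates at `α` show that it is extreme. The vector `-u` lies in the cone at `β` and has no
coordinates at `α` off `i`; nonnegativity then forces every generator at `β` that occurs in `-u` to
be a multiple of `u`. -/
theorem IsSimpleWithBases.exists_adjacent (h : IsSimpleWithBases P b) {x : V × Fin n}
    (hx : x.1 ∈ P.extremePoints ℝ) : ∃ y, Adjacent P b x y := by
  obtain ⟨α, i⟩ := x
  change α ∈ P.extremePoints ℝ at hx
  set u := b α i with hu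
  have hu0 : u ≠ 0 := (b α).ne_zero i
  obtain ⟨ε, hε, hεP⟩ := h.exists_edge α hx i
  let S : Set ℝ := (fun t : ℝ => α + t • u) ⁻¹' P
  have hemb : Topology.IsClosedEmbedding (fun t : ℝ => α + t • u) :=
    (Homeomorph.addLeft α).isClosedEmbedding.comp (isClosedEmbedding_smul_left hu0)
  have hS : IsCompact S := hemb.isCompact_preimage h.compact
  obtain ⟨T, hTS, hT⟩ := hS.exists_isGreatest ⟨ε, hεP⟩
  have hT0 : 0 < T := hε.trans_le (hT hεP)
  have hβ : α + T • u ∈ P.extremePoints ℝ := by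
    have key : ∀ y₁ ∈ P, ∀ y₂ ∈ P, ∀ r s : ℝ, 0 < r → 0 < s → r + s = 1 →
        r • y₁ + s • y₂ = α + T • u → y₁ = α + T • u := by
      intro y₁ h₁ y₂ h₂ r s hr hs hrs e
      have e' : r • (y₁ - α) + s • (y₂ - α) = T • u := by
        have : r • (y₁ - α) + s • (y₂ - α) = (r • y₁ + s • y₂) - (r + s) • α := by
          module
        rw [this, e, hrs, one_smul]; abel
      have line : ∀ y ∈ P, (∀ k ≠ i, (b α).repr (y - α) k = 0) →
          y = α + (b α).repr (y - α) i • u := by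
        intro y _ hk
        rw [← sub_eq_iff_eq_add']
        conv_lhs => rw [← (b α).sum_repr (y - α)]
        rw [Finset.sum_eq_single i (fun k _ hki => by rw [hk k hki, zero_smul]) (by simp)]
      have hz : ∀ k ≠ i, (b α).repr (y₁ - α) k = 0 ∧ (b α).repr (y₂ - α) k = 0 := by
        intro k hk
        have h3 := congrArg (fun v => (b α).repr v k) e'
        simp only [map_add, map_smul, Finsupp.add_apply, Finsupp.smul_apply, smul_eq_mul, hu,
          Basis.repr_self, Finsupp.single_apply, if_neg (Ne.symm hk), mul_zero] at h3
        have p1 := h.repr_nonneg α hx y₁ h₁ k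
        have p2 := h.repr_nonneg α hx y₂ h₂ k
        have q1 := mul_nonneg hr.le p1
        have q2 := mul_nonneg hs.le p2
        constructor
        · have : r * (b α).repr (y₁ - α) k = 0 := by linarith
          exact (mul_eq_zero.1 this).resolve_left hr.ne'
        · have : s * (b α).repr (y₂ - α) k = 0 := by linarith
          exact (mul_eq_zero.1 this).resolve_left hs.ne'
      have l1 := line y₁ h₁ fun k hk => (hz k hk).1
      have l2 := line y₂ h₂ fun k hk => (hz k hk).2
      have t1 : (b α).repr (y₁ - α) i ≤ T := hT (show α + _ • u ∈ P from l1 ▸ h₁)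
      have t2 : (b α).repr (y₂ - α) i ≤ T := hT (show α + _ • u ∈ P from l2 ▸ h₂)
      have h3 := congrArg (fun v => (b α).repr v i) e'
      simp only [map_add, map_smul, Finsupp.add_apply, Finsupp.smul_apply, smul_eq_mul, hu,
          Basis.repr_self, Finsupp.single_apply, if_true, mul_one] at h3
      have : (b α).repr (y₁ - α) i = T := by
        refine le_antisymm t1 ?_
        by_contra hlt
        push Not at hlt
        have a1 := mul_lt_mul_of_pos_left hlt hr
        have a2 := mul_le_mul_of_nonneg_left t2 hs.le
        have a3 : r * T + s * T = T := by rw [← add_mul, hrs, one_mul]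
        linarith
      rw [l1, this]
    rw [mem_extremePoints]
    refine ⟨hTS, fun y₁ h₁ y₂ h₂ ⟨r, s, hr, hs, hrs, e⟩ => ⟨key y₁ h₁ y₂ h₂ r s hr hs hrs e,
      key y₂ h₂ y₁ h₁ s r hs hr (by rw [add_comm, hrs]) (by rw [add_comm, e])⟩⟩
  set β := α + T • u with hβdef
  have hc0 : ∀ k, 0 ≤ (b β).repr (-u) k := by
    intro k
    have := h.repr_nonneg β hβ α hx.1 k
    rw [show α - β = T • -u by rw [hβdef, smul_neg]; abel, map_smul, Finsupp.smul_apply,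
      smul_eq_mul] at this
    exact nonneg_of_mul_nonneg_right this hT0
  have hnn : ∀ m, ∀ k ≠ i, 0 ≤ (b α).repr (b β m) k := by
    intro m k hk
    obtain ⟨δ, hδ, hm⟩ := h.exists_edge _ hβ m
    have h1 := h.repr_nonneg _ hx _ hm k
    rw [show β + δ • b β m - α = T • u + δ • b β m by rw [hβdef]; abel] at h1
    simp [hu, Ne.symm hk] at h1
    exact nonneg_of_mul_nonneg_right h1 hδ
  obtain ⟨j, hj⟩ : ∃ j, (b β).repr (-u) j ≠ 0 := by
    by_contra! hall
    apply hu0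
    rw [← neg_eq_zero, ← (b β).sum_repr (-u)]
    simp only [hall, zero_smul, Finset.sum_const_zero]
  have hj0 := lt_of_le_of_ne (hc0 j) (Ne.symm hj)
  have hz : ∀ k ≠ i, (b α).repr (b β j) k = 0 := by
    intro k hk
    have e : ∑ m, (b β).repr (-u) m * (b α).repr (b β m) k = 0 := by
      rw [← repr_eq_sum_repr]
      simp [hu, Ne.symm hk]
    have := (Finset.sum_eq_zero_iff_of_nonneg
      (fun m _ => mul_nonneg (hc0 m) (hnn m k hk))).1 e j (Finset.mem_univ _)
    exact (mul_eq_zero.1 this).resolve_left hj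
  have hbj : b β j = (b α).repr (b β j) i • u := by
    conv_lhs => rw [← (b α).sum_repr (b β j)]
    rw [Finset.sum_eq_single i (fun k _ hki => by rw [hz k hki, zero_smul]) (by simp)]
  have h4 := congrArg (fun v => (b β).repr v j) hbj
  simp only [Basis.repr_self, Finsupp.single_apply, if_true, map_smul, Finsupp.smul_apply,
    smul_eq_mul] at h4
  simp only [map_neg, Finsupp.neg_apply] at hj0
  refine ⟨(β, j), hx, hβ, ⟨T, hT0, rfl⟩, -(b α).repr (b β j) i, ?_, ?_⟩
  -- By `h4`, this multiple times the `j`-th coordinate of `u` at `β` is `1`, and that coordinate is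
  -- negative.
  · by_contra hneg
    have : 0 ≤ (b α).repr (b β j) i := by linarith
    nlinarith
  · simpa using hbj

/-- The facets containing an edge correspond at the two ends of the edge. -/
theorem Adjacent.exists_perm (h : IsSimpleWithBases P b) {x y : V × Fin n}
    (hxy : Adjacent P b x y) : ∃ π : Equiv.Perm (Fin n), π x.2 = y.2 ∧ ∀ k ≠ x.2, ∃ c : ℝ, 0 < c ∧
      (∀ v, (b y.1).repr (v - y.1) (π k) = c * (b x.1).repr (v - x.1) k) ∧
      ∃ d : ℝ, b x.1 k = c • b y.1 (π k) + d • b x.1 x.2 := by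
  have hA := fun k (hk : k ≠ x.2) => hxy.repr_nonneg h hk
  have hB := fun k (hk : k ≠ y.2) => hxy.symm.repr_nonneg h hk
  obtain ⟨hx, hy, ⟨T, hT, e⟩, c, hc, hb⟩ := hxy
  obtain ⟨α, i⟩ := x
  obtain ⟨β, j⟩ := y
  dsimp only at *
  have hαj : ∀ k ≠ i, (b α).repr (b β j) k = 0 := by
    intro k hk
    rw [hb]; simp [Ne.symm hk]
  have hbi : b α i = -(c⁻¹ • b β j) := by
    rw [hb, smul_neg, smul_smul, inv_mul_cancel₀ hc.ne', one_smul, neg_neg]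
  have hβi : ∀ m ≠ j, (b β).repr (b α i) m = 0 := by
    intro m hm
    rw [hbi]; simp [Ne.symm hm]
  -- Off `i` and `j`, the two change-of-basis matrices are nonnegative and inverse to each other,
  -- hence monomial: a sum of nonnegative products equal to `0` has only zero terms.
  have hex : ∀ k ≠ i, ∃ m ≠ j, 0 < (b β).repr (b α k) m ∧
      ∀ v, (b β).repr v m = (b β).repr (b α k) m * (b α).repr v k := by
    intro k hk
    have hterm : ∀ m, m ≠ j ∨ (b α).repr (b β m) k = 0 := fun m => by
      by_cases hm : m = j
      · right; rw [hm]; exact hαj k hk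
      · left; exact hm
    have hsum : ∀ k', ∑ m, (b β).repr (b α k') m * (b α).repr (b β m) k =
        if k' = k then 1 else 0 := by
      intro k'
      rw [← repr_eq_sum_repr, Basis.repr_self, Finsupp.single_apply]
    have hnn : ∀ k' m, 0 ≤ (b β).repr (b α k') m * (b α).repr (b β m) k := by
      intro k' m
      rcases hterm m with hm | hm
      · exact mul_nonneg (hB m hm k') (hA k hk m)
      · rw [hm, mul_zero]
    obtain ⟨m, -, hm⟩ : ∃ m ∈ Finset.univ, (b β).repr (b α k) m * (b α).repr (b β m) k ≠ 0 := by
      apply Finset.exists_ne_zero_of_sum_ne_zero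
      rw [hsum k]; simp
    have hm2 := right_ne_zero_of_mul hm
    have hmj : m ≠ j := by
      rintro rfl
      exact hm2 (hαj k hk)
    refine ⟨m, hmj, lt_of_le_of_ne (hB m hmj k) (Ne.symm (left_ne_zero_of_mul hm)), fun v => ?_⟩
    have hz : ∀ k' ≠ k, (b β).repr (b α k') m = 0 := by
      intro k' hk'
      have h0 := hsum k'
      rw [if_neg hk'] at h0
      have := (Finset.sum_eq_zero_iff_of_nonneg (fun m _ => hnn k' m)).1 h0 m (Finset.mem_univ _)
      exact (mul_eq_zero.1 this).resolve_right hm2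
    rw [repr_eq_sum_repr (b β) (b α),
      Finset.sum_eq_single k (fun k' _ hk' => by rw [hz k' hk', mul_zero]) (by simp), mul_comm]
  choose! f hfj hf0 hf using hex
  have hinj : Function.Injective fun k => if k = i then j else f k := by
    intro k k' hkk
    dsimp only at hkk
    by_cases h1 : k = i <;> by_cases h2 : k' = i
    · rw [h1, h2]
    · rw [if_pos h1, if_neg h2] at hkk
      exact absurd hkk.symm (hfj k' h2)
    · rw [if_neg h1, if_pos h2] at hkk
      exact absurd hkk (hfj k h1)
    · rw [if_neg h1, if_neg h2] at hkk
      by_contra hne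
      have h3 := hf k' h2 (b α k)
      rw [← hkk] at h3
      have h4 := hf0 k h1
      rw [h3] at h4
      simp [hne] at h4
  let π : Equiv.Perm (Fin n) := Equiv.ofBijective _ (Finite.injective_iff_bijective.1 hinj)
  have hπ : ∀ k, π k = if k = i then j else f k := fun _ => rfl
  refine ⟨π, by simp [hπ], fun k hk => ⟨(b β).repr (b α k) (f k), hf0 k hk, fun v => ?_, ?_⟩⟩
  · rw [hπ, if_neg hk, show v - β = (v - α) - T • b α i by rw [e]; abel, map_sub, map_smul,
      Finsupp.sub_apply, Finsupp.smul_apply, hβi _ (hfj k hk), smul_zero, sub_zero, hf k hk]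
  -- Off `i` the coordinates at `α` already agree; this coefficient cancels the `i`-th one.
  · refine ⟨-((b β).repr (b α k) (f k) * (b α).repr (b β (f k)) i), ?_⟩
    apply (b α).repr.injective
    ext k'
    rw [hπ, if_neg hk]
    simp only [map_add, map_smul, Finsupp.add_apply, Finsupp.smul_apply, smul_eq_mul,
      Basis.repr_self, Finsupp.single_apply]
    by_cases hk' : k' = i
    · subst hk'
      simp [hk]
    · have h5 := hf k' hk' (b β (f k))
      have hff : f k = f k' ↔ k = k' := by
        constructor
        · intro hh
          exact hinj (by simp [hk, hk', hh])
        · rintro rfl; rfl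
      simp only [Basis.repr_self, Finsupp.single_apply, hff] at h5
      by_cases hkk : k = k'
      · subst hkk
        simp [Ne.symm hk] at h5 ⊢
        exact h5
      · rw [if_neg hkk] at h5
        have h6 := (mul_eq_zero.1 h5.symm).resolve_left (hf0 k' hk').ne'
        simp [hkk, Ne.symm hk', h6]

end LatticePolytope

/-! ### Wall crossing and the Lawrence–Varchenko decomposition. -/

namespace LatticePolytope

open Module

variable {V : Type*} [NormedAddCommGroup V] [NormedSpace ℝ V] {n : ℕ} {P : Set V}
  {b : V → Basis (Fin n) ℝ V}

/-- The sign of a real number, with the convention that `0` is positive. -/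
noncomputable def sgn (a : ℝ) : ℝ := if 0 ≤ a then 1 else -1

theorem sgn_mul_of_pos {c : ℝ} (hc : 0 < c) (a : ℝ) : sgn (c * a) = sgn a := by
  simp only [sgn, mul_nonneg_iff_of_pos_left hc]

/-- The signed indicator function of the cone generated by the basis `B`, in which the generators
on which `ζ` is negative are flipped and the corresponding facets removed. -/
noncomputable def flippedCone (ζ : Dual ℝ V) (B : Basis (Fin n) ℝ V) (v : V) : ℝ :=
  ∏ i, (sgn (B.repr v i) + (SignType.sign (ζ (B i)) : ℝ)) / 2

/-- The change of the signed indicator function when `ζ` crosses a wall. -/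
theorem flippedCone_sub_flippedCone {ζ₀ ζ₁ : Dual ℝ V} {B : Basis (Fin n) ℝ V}
    (h₀ : ∀ i j, ζ₀ (B i) = 0 → ζ₀ (B j) = 0 → i = j)
    (h₁ : ∀ i, ζ₀ (B i) ≠ 0 → SignType.sign (ζ₁ (B i)) = SignType.sign (ζ₀ (B i))) (v : V) :
    flippedCone ζ₁ B v - flippedCone ζ₀ B v =
      ∑ i with ζ₀ (B i) = 0, (SignType.sign (ζ₁ (B i)) : ℝ) / 2 *
        ∏ k ∈ Finset.univ.erase i, (sgn (B.repr v k) + (SignType.sign (ζ₀ (B k)) : ℝ)) / 2 := by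
  by_cases hex : ∃ i, ζ₀ (B i) = 0
  · obtain ⟨i, hi⟩ := hex
    have hfil : (Finset.univ.filter fun j => ζ₀ (B j) = 0) = {i} := by
      ext j
      simp only [Finset.mem_filter, Finset.mem_univ, true_and, Finset.mem_singleton]
      exact ⟨fun hj => h₀ _ _ hj hi, fun hj => hj ▸ hi⟩
    rw [hfil, Finset.sum_singleton]
    simp only [flippedCone]
    rw [← Finset.mul_prod_erase _ _ (Finset.mem_univ i),
      ← Finset.mul_prod_erase _ (fun j => (sgn (B.repr v j) + (SignType.sign (ζ₀ (B j)) : ℝ)) / 2)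
        (Finset.mem_univ i)]
    have : ∀ k ∈ Finset.univ.erase i,
        (sgn (B.repr v k) + (SignType.sign (ζ₁ (B k)) : ℝ)) / 2 =
        (sgn (B.repr v k) + (SignType.sign (ζ₀ (B k)) : ℝ)) / 2 := by
      intro k hk
      rw [h₁ k fun hk0 => (Finset.ne_of_mem_erase hk) (h₀ _ _ hk0 hi)]
    rw [Finset.prod_congr rfl this, ← sub_mul, hi]
    -- Since `sign 0 = 0`, the factor on the wall is `sgn / 2`, the mean of its values on the two
    -- sides.
    simp only [sign_zero, SignType.coe_zero]
    ring
  · push Not at hex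
    rw [Finset.filter_false_of_mem fun i _ => hex i, Finset.sum_empty, sub_eq_zero]
    exact Finset.prod_congr rfl fun i _ => by rw [h₁ i (hex i)]

/-- The jumps are indexed by pairs of a vertex and a generator killed by `ζ₀`. Passing to the other
end of the edge is a fixed-point-free involution on these pairs, and it reverses the sign of the
jump. -/
theorem IsSimpleWithBases.sum_flippedCone_eq_of_sign_eq (h : IsSimpleWithBases P b)
    {ζ₀ ζ₁ : Dual ℝ V}
    (h₀ : ∀ α ∈ P.extremePoints ℝ, ∀ i j, ζ₀ (b α i) = 0 → ζ₀ (b α j) = 0 → i = j)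
    (h₁ : ∀ α ∈ P.extremePoints ℝ, ∀ i, ζ₀ (b α i) ≠ 0 →
      SignType.sign (ζ₁ (b α i)) = SignType.sign (ζ₀ (b α i))) (v : V) :
    ∑ α ∈ h.finite.toFinset, flippedCone ζ₁ (b α) (v - α) =
      ∑ α ∈ h.finite.toFinset, flippedCone ζ₀ (b α) (v - α) := by
  classical
  rw [← sub_eq_zero, ← Finset.sum_sub_distrib,
    Finset.sum_congr rfl fun α hα => flippedCone_sub_flippedCone
      (h₀ α (h.finite.mem_toFinset.1 hα)) (h₁ α (h.finite.mem_toFinset.1 hα)) (v - α)]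
  have hadj : ∀ x : V × Fin n, ∃ y, x.1 ∈ P.extremePoints ℝ → Adjacent P b x y := fun x => by
    by_cases hx : x.1 ∈ P.extremePoints ℝ
    · obtain ⟨y, hy⟩ := h.exists_adjacent hx
      exact ⟨y, fun _ => hy⟩
    · exact ⟨x, fun h => absurd h hx⟩
  choose opp hopp using hadj
  let f : V × Fin n → ℝ := fun x => (SignType.sign (ζ₁ (b x.1 x.2)) : ℝ) / 2 *
    ∏ k ∈ Finset.univ.erase x.2,
      (sgn ((b x.1).repr (v - x.1) k) + (SignType.sign (ζ₀ (b x.1 k)) : ℝ)) / 2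
  let s : Finset (V × Fin n) :=
    (h.finite.toFinset ×ˢ Finset.univ).filter fun x => ζ₀ (b x.1 x.2) = 0
  have hs : ∀ x, x ∈ s ↔ x.1 ∈ P.extremePoints ℝ ∧ ζ₀ (b x.1 x.2) = 0 := fun x => by
    simp [s]
  have hsum : ∑ x ∈ s, f x = 0 := by
    refine Finset.sum_involution (fun x _ => opp x) ?_ ?_ ?_ ?_
    · intro x hx
      obtain ⟨hx, hx0⟩ := (hs x).1 hx
      have hxy := hopp x hx
      obtain ⟨π, hπ, hk⟩ := hxy.exists_perm h
      obtain ⟨-, -, -, c, hc, hb⟩ := hxy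
      set y := opp x
      have hsign : (SignType.sign (ζ₁ (b y.1 y.2)) : ℝ) = -SignType.sign (ζ₁ (b x.1 x.2)) := by
        rw [hb, map_neg, map_smul, smul_eq_mul, Left.sign_neg, sign_mul, sign_pos hc, one_mul]
        simp
      have hprod : ∏ k ∈ Finset.univ.erase x.2,
          (sgn ((b x.1).repr (v - x.1) k) + (SignType.sign (ζ₀ (b x.1 k)) : ℝ)) / 2 =
          ∏ k ∈ Finset.univ.erase y.2,
          (sgn ((b y.1).repr (v - y.1) k) + (SignType.sign (ζ₀ (b y.1 k)) : ℝ)) / 2 := by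
        -- Matched coordinates differ by a positive factor. So do the values of `ζ₀` on matched
        -- generators, because `ζ₀` kills the edge direction.
        refine Finset.prod_equiv π (fun k => ?_) (fun k hk' => ?_)
        · simp [← hπ]
        · obtain ⟨d, hd, hv, e, he⟩ := hk k (Finset.ne_of_mem_erase hk')
          rw [hv, sgn_mul_of_pos hd, he, map_add, map_smul, map_smul, hx0, smul_zero, add_zero,
            smul_eq_mul, sign_mul, sign_pos hd, one_mul]
      simp only [f, hsign, hprod]
      ring
    · intro x hx _
      exact (hopp x ((hs x).1 hx).1).ne
    · intro x hx
      obtain ⟨hx, hx0⟩ := (hs x).1 hx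
      obtain ⟨-, hy, -, c, hc, hb⟩ := hopp x hx
      rw [hs]
      exact ⟨hy, by rw [hb, map_neg, map_smul, hx0, smul_zero, neg_zero]⟩
    · intro x hx
      have hxy := hopp x ((hs x).1 hx).1
      exact (hopp _ hxy.2.1).unique hxy.symm
  refine Eq.trans ?_ hsum
  rw [Finset.sum_filter, Finset.sum_product]
  exact Finset.sum_congr rfl fun α _ => by rw [Finset.sum_filter]

/-- Nonzero minors ensure that the segment from `ζ₀` to `ζ₁` never meets two walls of the same
vertex at once, so the sum is locally constant along it. -/
theorem IsSimpleWithBases.sum_flippedCone_eq_of_independent (h : IsSimpleWithBases P b)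
    {ζ₀ ζ₁ : Dual ℝ V}
    (hi : ∀ α ∈ P.extremePoints ℝ, ∀ i j, i ≠ j →
      ζ₀ (b α i) * ζ₁ (b α j) - ζ₀ (b α j) * ζ₁ (b α i) ≠ 0) (v : V) :
    ∑ α ∈ h.finite.toFinset, flippedCone ζ₁ (b α) (v - α) =
      ∑ α ∈ h.finite.toFinset, flippedCone ζ₀ (b α) (v - α) := by
  let ζ : ℝ → Dual ℝ V := fun t => (1 - t) • ζ₀ + t • ζ₁
  have hζ : ∀ t w, ζ t w = (1 - t) * ζ₀ w + t * ζ₁ w := fun t w => by simp [ζ]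
  let g : ℝ → ℝ := fun t => ∑ α ∈ h.finite.toFinset, flippedCone (ζ t) (b α) (v - α)
  have hg : IsLocallyConstant g := by
    rw [IsLocallyConstant.iff_eventually_eq]
    intro t
    have hev : ∀ᶠ u in nhds t, ∀ α ∈ P.extremePoints ℝ, ∀ i, ζ t (b α i) ≠ 0 →
        SignType.sign (ζ u (b α i)) = SignType.sign (ζ t (b α i)) := by
      rw [Filter.eventually_all_finite h.finite]
      intro α _
      rw [Filter.eventually_all]
      intro i
      by_cases h0 : ζ t (b α i) = 0
      · exact Filter.Eventually.of_forall fun u hu => absurd h0 hu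
      · have hc : Continuous fun u => ζ u (b α i) := by
          simp only [hζ]
          fun_prop
        have hs := (continuousAt_sign_of_ne_zero h0).comp (f := fun u => ζ u (b α i))
          hc.continuousAt
        exact (hs.eventually (IsOpen.mem_nhds (isOpen_discrete {_}) rfl)).mono fun u hu _ => hu
    filter_upwards [hev] with u hu
    refine h.sum_flippedCone_eq_of_sign_eq (fun α hα i j h1 h2 => ?_) hu v
    by_contra hne
    have hd := hi α hα i j hne
    rw [hζ] at h1 h2
    have e1 : (1 - t) * (ζ₀ (b α i) * ζ₁ (b α j) - ζ₀ (b α j) * ζ₁ (b α i)) = 0 := by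
      linear_combination ζ₁ (b α j) * h1 - ζ₁ (b α i) * h2
    have e2 : t * (ζ₀ (b α i) * ζ₁ (b α j) - ζ₀ (b α j) * ζ₁ (b α i)) = 0 := by
      linear_combination ζ₀ (b α i) * h2 - ζ₀ (b α j) * h1
    have e3 := (mul_eq_zero.1 e1).resolve_right hd
    have e4 := (mul_eq_zero.1 e2).resolve_right hd
    linarith
  have := hg.apply_eq_of_isPreconnected isPreconnected_univ (Set.mem_univ 1) (Set.mem_univ 0)
  simpa [g, ζ] using this

/-- A small generic perturbation of a linear form. -/
theorem exists_perturbation {ι κ : Type*} [Finite ι] [Finite κ] (ζ : Dual ℝ V) (u : ι → V)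
    (hu : ∀ i, 0 < ζ (u i)) (w : κ → V) (hw : ∀ k, w k ≠ 0) :
    ∃ ξ : Dual ℝ V, (∀ i, 0 < ξ (u i)) ∧ ∀ k, ξ (w k) ≠ 0 := by
  obtain ⟨η, hη⟩ := exists_dual_forall_apply_ne_zero (K := ℝ) w hw
  have h1 : ∀ᶠ t : ℝ in nhdsWithin 0 {0}ᶜ, ∀ i, 0 < (ζ + t • η) (u i) := by
    rw [Filter.eventually_all]
    intro i
    have hc : ContinuousAt (fun t : ℝ => (ζ + t • η) (u i)) 0 := by
      simp only [LinearMap.add_apply, LinearMap.smul_apply, smul_eq_mul]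
      fun_prop
    exact nhdsWithin_le_nhds (hc.eventually (lt_mem_nhds (by simpa using hu i)))
  have h2 : ∀ᶠ t : ℝ in nhdsWithin 0 {0}ᶜ, ∀ k, (ζ + t • η) (w k) ≠ 0 := by
    rw [Filter.eventually_all]
    intro k
    -- Each `w k` excludes a single value of `t`; the punctured neighbourhood covers the case where
    -- this value is `0`.
    have : ∀ᶠ t : ℝ in nhdsWithin 0 {0}ᶜ, t ≠ -(ζ (w k) / η (w k)) := by
      by_cases h0 : -(ζ (w k) / η (w k)) = 0
      · rw [h0]; exact self_mem_nhdsWithin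
      · exact nhdsWithin_le_nhds (isOpen_ne.mem_nhds (Ne.symm h0))
    filter_upwards [this] with t ht h0
    apply ht
    simp only [LinearMap.add_apply, LinearMap.smul_apply, smul_eq_mul] at h0
    have := hη k
    field_simp
    linarith
  obtain ⟨t, h1, h2⟩ := (h1.and h2).exists
  exact ⟨_, h1, h2⟩

theorem apply_eq_sum_repr (B : Basis (Fin n) ℝ V) (ζ : Dual ℝ V) (v : V) :
    ζ v = ∑ i, B.repr v i * ζ (B i) := by
  conv_lhs => rw [← B.sum_repr v]
  simp only [map_sum, map_smul, smul_eq_mul]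

/-- A nonzero factor forces the coordinate and the value of `ζ` on the generator to have compatible
signs, so `ζ` is nonnegative on the whole flipped cone. -/
theorem flippedCone_eq_zero_of_neg {ζ : Dual ℝ V} {B : Basis (Fin n) ℝ V}
    (hζ : ∀ i, ζ (B i) ≠ 0) {v : V} (hv : ζ v < 0) : flippedCone ζ B v = 0 := by
  by_contra hne
  rw [flippedCone, ← ne_eq, Finset.prod_ne_zero_iff] at hne
  have h2 : 0 ≤ ζ v := by
    rw [apply_eq_sum_repr B]
    refine Finset.sum_nonneg fun i _ => ?_
    have h3 := hne i (Finset.mem_univ i)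
    rcases lt_or_gt_of_ne (hζ i) with hneg | hpos
    · rw [sign_neg hneg] at h3
      by_cases h4 : 0 ≤ B.repr v i
      · simp [sgn, h4] at h3
      · exact mul_nonneg_of_nonpos_of_nonpos (le_of_not_ge h4) hneg.le
    · rw [sign_pos hpos] at h3
      by_cases h4 : 0 ≤ B.repr v i
      · exact mul_nonneg h4 hpos.le
      · simp [sgn, h4] at h3
  linarith

theorem flippedCone_of_nonneg {ζ : Dual ℝ V} {B : Basis (Fin n) ℝ V}
    (hζ : ∀ i, ζ (B i) ≠ 0) {v : V} (hv : ∀ i, 0 ≤ B.repr v i) [Decidable (∀ i, 0 < ζ (B i))] :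
    flippedCone ζ B v = if ∀ i, 0 < ζ (B i) then 1 else 0 := by
  split_ifs with h
  · exact Finset.prod_eq_one fun i _ => by simp [sgn, hv i, sign_pos (h i)]
  · push Not at h
    obtain ⟨i, hi⟩ := h
    exact Finset.prod_eq_zero (Finset.mem_univ i)
      (by simp [sgn, hv i, sign_neg (lt_of_le_of_ne hi (hζ i))])

/-- An extreme point of the face where `ζ` is minimal is a vertex of `P`, and `ζ` is positive on its
generators by genericity. Conversely, such positivity makes a vertex the only minimiser of `ζ` on
`P`. -/
theorem IsSimpleWithBases.existsUnique_min [FiniteDimensional ℝ V] (h : IsSimpleWithBases P b)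
    {ζ : Dual ℝ V} (hζ : ∀ α ∈ P.extremePoints ℝ, ∀ i, ζ (b α i) ≠ 0) :
    ∃! α, α ∈ P.extremePoints ℝ ∧ ∀ i, 0 < ζ (b α i) := by
  have hc : Continuous ζ := ζ.continuous_of_finiteDimensional
  obtain ⟨x₀, hx₀, hmin⟩ := h.compact.exists_isMinOn h.nonempty hc.continuousOn
  let F : Set V := {x ∈ P | ζ x = ζ x₀}
  have hF : IsCompact F := h.compact.inter_right (isClosed_eq hc continuous_const)
  obtain ⟨α, hα⟩ := hF.extremePoints_nonempty ⟨x₀, hx₀, rfl⟩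
  have hext : IsExtreme ℝ P F := by
    refine ⟨fun x hx => hx.1, fun x hx y hy z hz hzs => ⟨hx, ?_⟩⟩
    obtain ⟨r, s, hr, hs, hrs, rfl⟩ := hzs
    have h1 := hz.2
    simp only [map_add, map_smul, smul_eq_mul] at h1
    have h2 : ζ x₀ ≤ ζ x := hmin hx
    have h3 : ζ x₀ ≤ ζ y := hmin hy
    refine le_antisymm ?_ h2
    by_contra hlt
    push Not at hlt
    have a1 := mul_lt_mul_of_pos_left hlt hr
    have a2 := mul_le_mul_of_nonneg_left h3 hs.le
    have a3 : r * ζ x₀ + s * ζ x₀ = ζ x₀ := by rw [← add_mul, hrs, one_mul]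
    linarith
  have hαP := hext.extremePoints_subset_extremePoints hα
  refine ⟨α, ⟨hαP, fun i => ?_⟩, ?_⟩
  · obtain ⟨ε, hε, he⟩ := h.exists_edge α hαP i
    have h1 : ζ x₀ ≤ ζ (α + ε • b α i) := hmin he
    rw [← hα.1.2, map_add, map_smul, smul_eq_mul] at h1
    have h2 : 0 ≤ ε * ζ (b α i) := by linarith
    exact lt_of_le_of_ne (nonneg_of_mul_nonneg_right h2 hε) (Ne.symm (hζ α hαP i))
  · have key : ∀ γ ∈ P.extremePoints ℝ, (∀ i, 0 < ζ (b γ i)) → ∀ v ∈ P, ζ v ≤ ζ γ → v = γ := by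
      intro γ hγ hpos v hv hle
      have hnn := h.repr_nonneg γ hγ v hv
      have h2 : ∑ i, (b γ).repr (v - γ) i * ζ (b γ i) = 0 := by
        refine le_antisymm ?_ (Finset.sum_nonneg fun i _ => mul_nonneg (hnn i) (hpos i).le)
        rw [← apply_eq_sum_repr, map_sub]
        linarith
      have h3 := (Finset.sum_eq_zero_iff_of_nonneg
        fun i _ => mul_nonneg (hnn i) (hpos i).le).1 h2
      rw [← sub_eq_zero, ← (b γ).sum_repr (v - γ)]
      refine Finset.sum_eq_zero fun i hi => ?_
      rw [(mul_eq_zero.1 (h3 i hi)).resolve_right (hpos i).ne', zero_smul]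
    rintro γ ⟨hγ, hpos⟩
    exact (key γ hγ hpos α hαP.1 (hα.1.2.trans_le (hmin hγ.1))).symm

/-- The Lawrence–Varchenko decomposition: the signed indicator functions of the flipped tangent
cones at the vertices of a simple polytope add up to the indicator function of the polytope. -/
theorem IsSimpleWithBases.sum_flippedCone [FiniteDimensional ℝ V] (h : IsSimpleWithBases P b)
    {ζ : Dual ℝ V} (hζ : ∀ α ∈ P.extremePoints ℝ, ∀ i, ζ (b α i) ≠ 0) (v : V) :
    ∑ α ∈ h.finite.toFinset, flippedCone ζ (b α) (v - α) = P.indicator (fun _ => 1) v := by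
  classical
  by_cases hv : v ∈ P
  · rw [Set.indicator_of_mem hv]
    obtain ⟨α, ⟨hα, hpos⟩, huniq⟩ := h.existsUnique_min hζ
    rw [Finset.sum_eq_single_of_mem α (h.finite.mem_toFinset.2 hα)]
    · rw [flippedCone_of_nonneg (hζ α hα) (h.repr_nonneg α hα v hv), if_pos hpos]
    · intro γ hγ hne
      rw [h.finite.mem_toFinset] at hγ
      rw [flippedCone_of_nonneg (hζ γ hγ) (h.repr_nonneg γ hγ v hv), if_neg]
      exact fun hp => hne (huniq γ ⟨hγ, hp⟩)
  · rw [Set.indicator_of_notMem hv]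
    obtain ⟨f, u, hfv, hf⟩ := geometric_hahn_banach_point_closed h.convex h.compact.isClosed hv
    have := h.finite.to_subtype
    let E := P.extremePoints ℝ
    -- The separating functional is perturbed to be nonzero on two families of vectors: the
    -- generators, as needed for the vanishing of the terms, and combinations on which the value of
    -- `ξ` is a 2×2 minor of `ζ` and `ξ`.
    obtain ⟨ξ, hξ, hgen⟩ := exists_perturbation (f : Dual ℝ V) (fun α : E => α.1 - v)
      (fun α => by
        have := hf α α.2.1
        simp only [ContinuousLinearMap.coe_coe, map_sub]
        linarith)
      (Sum.elim (fun x : E × Fin n => b x.1.1 x.2)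
        (fun x : E × {p : Fin n × Fin n // p.1 ≠ p.2} =>
          ζ (b x.1.1 x.2.1.1) • b x.1.1 x.2.1.2 - ζ (b x.1.1 x.2.1.2) • b x.1.1 x.2.1.1))
      (by
        rintro (⟨α, i⟩ | ⟨α, ⟨i, j⟩, hij⟩)
        · exact (b α).ne_zero i
        · intro h0
          have := congrArg (fun w => (b α.1).repr w j) h0
          exact hζ α α.2 i (by simpa [Finsupp.single_apply, show i ≠ j from hij] using this))
    rw [h.sum_flippedCone_eq_of_independent (ζ₀ := ξ) (ζ₁ := ζ)]
    · refine Finset.sum_eq_zero fun α hα => ?_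
      rw [h.finite.mem_toFinset] at hα
      refine flippedCone_eq_zero_of_neg (fun i => hgen (Sum.inl (⟨α, hα⟩, i))) ?_
      have := hξ ⟨α, hα⟩
      rw [map_sub] at this ⊢
      linarith
    · intro α hα i j hij h0
      apply hgen (Sum.inr (⟨α, hα⟩, ⟨(i, j), hij⟩))
      simp only [Sum.elim_inr, map_sub, map_smul, smul_eq_mul]
      linarith

end LatticePolytope

/-! ### Todd series, formal generating functions and lattice points of cones. -/

namespace LatticePolytope

open Module PowerSeries

section Todd

/-- The formal power series `exp (-c X)`. -/
noncomputable def expNeg (c : ℝ) : PowerSeries ℝ := rescale (-c) (exp ℝ)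

theorem coeff_expNeg (c : ℝ) (j : ℕ) :
    coeff j (expNeg c) = (-1) ^ j / (j.factorial : ℝ) * c ^ j := by
  rw [expNeg, coeff_rescale, coeff_exp, neg_pow]
  simp
  ring

theorem expNeg_add (c d : ℝ) : expNeg (c + d) = expNeg c * expNeg d := by
  rw [expNeg, expNeg, expNeg, exp_mul_exp_eq_exp_add, neg_add]

theorem one_sub_expNeg_ne_zero {c : ℝ} (hc : c ≠ 0) : 1 - expNeg c ≠ 0 := by
  intro h
  have := congrArg (coeff 1) h
  simp [coeff_expNeg, coeff_one, hc] at this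

/-- The formal power series `c X / (1 - exp (-c X))`. -/
noncomputable def toddAt (c : ℝ) : PowerSeries ℝ := rescale c (map (algebraMap ℚ ℝ) toddSeries)

theorem one_sub_expNeg_mul_toddAt (c : ℝ) : (1 - expNeg c) * toddAt c = C c * X := by
  have h := congrArg (fun p => rescale c (map (algebraMap ℚ ℝ) p)) toddSeries_mul
  simp only [map_mul, map_sub, map_one, map_X] at h
  have h1 : rescale c (map (algebraMap ℚ ℝ) (evalNegHom (exp ℚ))) = expNeg c := by
    ext k
    simp [expNeg, evalNegHom, coeff_rescale, coeff_exp, neg_pow c]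
    ring
  have h2 : rescale c (X : PowerSeries ℝ) = C c * X := by
    ext k
    simp [coeff_X]
  rw [h1, h2] at h
  rw [mul_comm]
  exact h

theorem coeff_prod_toddAt {n : ℕ} (x : Fin n → ℝ) (k : ℕ) :
    coeff k (∏ i, toddAt (x i)) = MvPolynomial.aeval x (toddPolynomial n k) := by
  have h : ∏ i, toddAt (x i) =
      map (MvPolynomial.aeval x : MvPolynomial (Fin n) ℚ →ₐ[ℚ] ℝ).toRingHom
      (∏ i : Fin n, rescale (MvPolynomial.X i : MvPolynomial (Fin n) ℚ)
        (map (MvPolynomial.C : ℚ →+* MvPolynomial (Fin n) ℚ) toddSeries)) := by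
    rw [map_prod]
    refine Finset.prod_congr rfl fun i _ => ?_
    ext m
    simp [toddAt, coeff_rescale]
  rw [h, coeff_map]
  rfl

theorem coeff_sum_expNeg_mul_prod_toddAt {n : ℕ} (a : ℝ) {ι : Type*} (s : Finset ι) (c : ι → ℝ)
    (x : Fin n → ℝ) :
    coeff n (C a * ((∑ q ∈ s, expNeg (c q)) * ∏ i, toddAt (x i))) =
      a * ∑ j ∈ Finset.range (n + 1), (-1) ^ j / (j.factorial : ℝ) *
        ∑ q ∈ s, c q ^ j * MvPolynomial.aeval x (toddPolynomial n (n - j)) := by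
  rw [coeff_C_mul, coeff_mul, Finset.Nat.sum_antidiagonal_eq_sum_range_succ
    fun i j => coeff i (∑ q ∈ s, expNeg (c q)) * coeff j (∏ i, toddAt (x i))]
  congr 1
  refine Finset.sum_congr rfl fun j _ => ?_
  rw [map_sum, coeff_prod_toddAt, Finset.sum_mul, Finset.mul_sum]
  exact Finset.sum_congr rfl fun q _ => by rw [coeff_expNeg, mul_assoc]

theorem coeff_X_pow_mul_sum_expNeg (n : ℕ) {ι : Type*} (s : Finset ι) (c : ι → ℝ) :
    coeff n ((X : PowerSeries ℝ) ^ n * ∑ q ∈ s, expNeg (c q)) = s.card := by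
  rw [coeff_X_pow_mul', if_pos le_rfl, Nat.sub_self, map_sum,
    Finset.sum_congr rfl fun q _ => coeff_expNeg (c q) 0]
  simp

end Todd

section GeneratingFunctions

variable {V : Type*} [AddCommGroup V]

/-- The difference operator `F ↦ F - F (· - u)`. -/
def diff (u : V) : Module.End ℝ (V → ℝ) where
  toFun F v := F v - F (v - u)
  map_add' F G := by ext v; simp; ring
  map_smul' c F := by ext v; simp; ring

theorem diff_apply (u : V) (F : V → ℝ) (v : V) : diff u F v = F v - F (v - u) := rfl

theorem commute_diff (u w : V) : Commute (diff u) (diff w) := by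
  ext F v
  simp only [Module.End.mul_apply, diff_apply]
  rw [sub_right_comm v u w]
  ring

/-- The composition of the difference operators of a list of vectors. -/
def diffs (L : List V) : Module.End ℝ (V → ℝ) := (L.map diff).prod

theorem diffs_cons (u : V) (L : List V) (F : V → ℝ) : diffs (u :: L) F = diff u (diffs L F) := by
  simp [diffs]

theorem diffs_append (L L' : List V) (F : V → ℝ) : diffs (L ++ L') F = diffs L (diffs L' F) := by
  simp [diffs]

theorem diffs_comm (L L' : List V) (F : V → ℝ) : diffs L (diffs L' F) = diffs L' (diffs L F) := by
  have : Commute (diffs L) (diffs L') := by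
    refine Commute.list_prod_left _ _ fun x hx => Commute.list_prod_right _ _ fun y hy => ?_
    obtain ⟨u, -, rfl⟩ := List.mem_map.1 hx
    obtain ⟨w, -, rfl⟩ := List.mem_map.1 hy
    exact commute_diff u w
  exact congrArg (fun f : Module.End ℝ (V → ℝ) => f F) this.eq

variable [Module ℝ V]

/-- The generating function `∑ m, G m exp (-ζ m X)` of a finitely supported function. -/
noncomputable def genFun (ζ : Dual ℝ V) : (V →₀ ℝ) →ₗ[ℝ] PowerSeries ℝ :=
  Finsupp.linearCombination ℝ fun m => expNeg (ζ m)

theorem genFun_sum_single (ζ : Dual ℝ V) {ι : Type*} (s : Finset ι) (f : ι → V) :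
    genFun ζ (∑ i ∈ s, Finsupp.single (f i) 1) = ∑ i ∈ s, expNeg (ζ (f i)) := by
  simp [genFun]

/-- The product of the series `1 - exp (-ζ u X)` over a list of vectors `u`. -/
noncomputable def denom (ζ : Dual ℝ V) (L : List V) : PowerSeries ℝ :=
  (L.map fun u => 1 - expNeg (ζ u)).prod

theorem denom_append (ζ : Dual ℝ V) (L L' : List V) :
    denom ζ (L ++ L') = denom ζ L * denom ζ L' := by
  simp [denom]

theorem denom_ne_zero {ζ : Dual ℝ V} {L : List V} (h : ∀ u ∈ L, ζ u ≠ 0) : denom ζ L ≠ 0 := by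
  rw [denom, ne_eq, List.prod_eq_zero_iff, List.mem_map]
  rintro ⟨u, hu, h0⟩
  exact one_sub_expNeg_ne_zero (h u hu) h0

/-- Translation by `u` multiplies the generating function by `exp (-ζ u X)`. -/
theorem exists_diff_coe (ζ : Dual ℝ V) (u : V) (G : V →₀ ℝ) :
    ∃ G' : V →₀ ℝ, diff u G = G' ∧ genFun ζ G' = (1 - expNeg (ζ u)) * genFun ζ G := by
  refine ⟨G - G.mapDomain (· + u), ?_, ?_⟩
  · ext v
    rw [diff_apply, Finsupp.sub_apply]
    congr 1
    conv_rhs => rw [← sub_add_cancel v u]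
    exact (Finsupp.mapDomain_apply (add_left_injective u) G (v - u)).symm
  · rw [map_sub, sub_mul, one_mul]
    congr 1
    rw [genFun, Finsupp.linearCombination_mapDomain, Finsupp.linearCombination_apply,
      Finsupp.linearCombination_apply, Finsupp.mul_sum]
    refine Finsupp.sum_congr fun m _ => ?_
    rw [Function.comp_apply, map_add, expNeg_add, mul_smul_comm, mul_comm]

theorem exists_diffs_coe (ζ : Dual ℝ V) (L : List V) (G : V →₀ ℝ) :
    ∃ G' : V →₀ ℝ, diffs L G = G' ∧ genFun ζ G' = denom ζ L * genFun ζ G := by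
  induction L with
  | nil => exact ⟨G, by simp [diffs], by simp [denom]⟩
  | cons u L ih =>
    obtain ⟨G₁, h₁, h₂⟩ := ih
    obtain ⟨G₂, h₃, h₄⟩ := exists_diff_coe ζ u G₁
    exact ⟨G₂, by rw [diffs_cons, h₁, h₃], by rw [h₄, h₂, ← mul_assoc]; simp [denom]⟩

/-- The function `F` becomes finitely supported after applying finitely many difference operators,
and its generating function is `p / X ^ n`. -/
def HasGenFun (n : ℕ) (ζ : Dual ℝ V) (F : V → ℝ) (p : PowerSeries ℝ) : Prop :=
  ∃ L : List V, (∀ u ∈ L, ζ u ≠ 0) ∧ ∃ G : V →₀ ℝ, diffs L F = G ∧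
    X ^ n * genFun ζ G = denom ζ L * p

theorem hasGenFun_coe (n : ℕ) (ζ : Dual ℝ V) (G : V →₀ ℝ) :
    HasGenFun n ζ G (X ^ n * genFun ζ G) :=
  ⟨[], by simp, G, by simp [diffs], by simp [denom]⟩

theorem HasGenFun.add {n : ℕ} {ζ : Dual ℝ V} {F F' : V → ℝ} {p p' : PowerSeries ℝ}
    (h : HasGenFun n ζ F p) (h' : HasGenFun n ζ F' p') : HasGenFun n ζ (F + F') (p + p') := by
  obtain ⟨L, hL, G, hG, hp⟩ := h
  obtain ⟨L', hL', G', hG', hp'⟩ := h'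
  obtain ⟨H, hH, hq⟩ := exists_diffs_coe ζ L' G
  obtain ⟨H', hH', hq'⟩ := exists_diffs_coe ζ L G'
  refine ⟨L ++ L', fun u hu => (List.mem_append.1 hu).elim (hL u) (hL' u), H + H', ?_, ?_⟩
  · rw [diffs_append, map_add, map_add, diffs_comm L L' F, hG, hG', hH, hH', Finsupp.coe_add]
  · rw [map_add, hq, hq', denom_append]
    linear_combination denom ζ L' * hp + denom ζ L * hp'

theorem HasGenFun.sum {n : ℕ} {ζ : Dual ℝ V} {ι : Type*} (s : Finset ι) {F : ι → V → ℝ}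
    {p : ι → PowerSeries ℝ} (h : ∀ i ∈ s, HasGenFun n ζ (F i) (p i)) :
    HasGenFun n ζ (∑ i ∈ s, F i) (∑ i ∈ s, p i) := by
  classical
  induction s using Finset.induction_on with
  | empty => simpa using hasGenFun_coe n ζ 0
  | insert i s hi ih =>
    rw [Finset.sum_insert hi, Finset.sum_insert hi]
    exact (h i (Finset.mem_insert_self i s)).add
      (ih fun j hj => h j (Finset.mem_insert_of_mem hj))

/-- Applying both lists of difference operators to `F` gives the same function in either order; the
denominators then cancel because `PowerSeries ℝ` is a domain. -/
theorem HasGenFun.unique {n : ℕ} {ζ : Dual ℝ V} {F : V → ℝ} {p p' : PowerSeries ℝ}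
    (h : HasGenFun n ζ F p) (h' : HasGenFun n ζ F p') : p = p' := by
  obtain ⟨L, hL, G, hG, hp⟩ := h
  obtain ⟨L', hL', G', hG', hp'⟩ := h'
  obtain ⟨H, hH, hq⟩ := exists_diffs_coe ζ L' G
  obtain ⟨H', hH', hq'⟩ := exists_diffs_coe ζ L G'
  have e : H = H' := by
    apply DFunLike.coe_injective
    rw [← hH, ← hH', ← hG, ← hG', diffs_comm]
  rw [← e, hq] at hq'
  apply mul_left_cancel₀ (denom_ne_zero hL)
  apply mul_left_cancel₀ (denom_ne_zero hL')
  linear_combination X ^ n * hq' - denom ζ L' * hp + denom ζ L * hp'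

end GeneratingFunctions

section Cones

variable {V : Type*} [NormedAddCommGroup V] [NormedSpace ℝ V] {n : ℕ}

/-- Translation by `B i` preserves `M` and changes only the `i`-th coordinate, by `1`. -/
theorem diff_prod_repr (M : Submodule ℤ V) (B : Basis (Fin n) ℝ V) (α : V)
    (h : Fin n → ℝ → ℝ) (i : Fin n) (hi : B i ∈ M) :
    diff (B i) (fun v => (M : Set V).indicator (fun _ => ∏ k, h k (B.repr (v - α) k)) v) =
      fun v => (M : Set V).indicator (fun _ => ∏ k, Function.update h i
        (fun a => h i a - h i (a - 1)) k (B.repr (v - α) k)) v := by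
  ext v
  rw [diff_apply]
  by_cases hv : v ∈ M
  · rw [Set.indicator_of_mem hv, Set.indicator_of_mem hv,
      Set.indicator_of_mem (show v - B i ∈ (M : Set V) from M.sub_mem hv hi),
      ← Finset.mul_prod_erase _ _ (Finset.mem_univ i),
      ← Finset.mul_prod_erase _ (fun k => h k (B.repr (v - B i - α) k)) (Finset.mem_univ i),
      ← Finset.mul_prod_erase _ (fun k => Function.update h i
        (fun a => h i a - h i (a - 1)) k (B.repr (v - α) k)) (Finset.mem_univ i),
      Function.update_self, sub_mul]
    have e : ∀ k, B.repr (v - B i - α) k = B.repr (v - α) k - if i = k then 1 else 0 := by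
      intro k
      rw [sub_right_comm, map_sub, Finsupp.sub_apply, Basis.repr_self, Finsupp.single_apply]
    congr 2
    · exact Finset.prod_congr rfl fun k hk => by
        rw [Function.update_of_ne (Finset.ne_of_mem_erase hk)]
    · rw [e, if_pos rfl]
    · exact Finset.prod_congr rfl fun k hk => by
        rw [Function.update_of_ne (Finset.ne_of_mem_erase hk), e,
          if_neg (Finset.ne_of_mem_erase hk).symm, sub_zero]
  · have hv' : v - B i ∉ M := fun h' => hv (by simpa using M.add_mem h' hi)
    rw [Set.indicator_of_notMem hv, Set.indicator_of_notMem hv,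
      Set.indicator_of_notMem (show v - B i ∉ (M : Set V) from hv'), sub_zero]

/-- The orientation `z` drops out: this is why a flipped cone and the original one yield the same
parallelepiped. The convention at `0` makes the interval closed on the left. -/
theorem sgn_sub_sgn_sub_one (a z : ℝ) :
    (sgn a + z) / 2 - (sgn (a - 1) + z) / 2 = if 0 ≤ a ∧ a < 1 then 1 else 0 := by
  by_cases h0 : 0 ≤ a <;> by_cases h1 : a < 1
  · simp [sgn, h0, h1, not_le.2 h1]
    ring
  · simp [sgn, h0, h1, not_lt.1 h1]
  · simp [sgn, h0, not_le.2 h1]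
  · exact absurd ((zero_le_one).trans (not_lt.1 h1)) h0

theorem diffs_flippedCone (M : Submodule ℤ V) (ζ : Dual ℝ V) (B : Basis (Fin n) ℝ V) (α : V)
    (hB : ∀ i, B i ∈ M) (l : List (Fin n)) (hl : l.Nodup) :
    diffs (l.map B) (fun v => (M : Set V).indicator (fun _ => flippedCone ζ B (v - α)) v) =
      fun v => (M : Set V).indicator (fun _ => ∏ k, if k ∈ l then
        (if 0 ≤ B.repr (v - α) k ∧ B.repr (v - α) k < 1 then 1 else 0) else
        (sgn (B.repr (v - α) k) + (SignType.sign (ζ (B k)) : ℝ)) / 2) v := by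
  induction l with
  | nil => simp [diffs, flippedCone]
  | cons i l ih =>
    rw [List.nodup_cons] at hl
    rw [List.map_cons, diffs_cons, ih hl.2,
      diff_prod_repr M B α (fun k a => if k ∈ l then (if 0 ≤ a ∧ a < 1 then 1 else 0) else
        (sgn a + (SignType.sign (ζ (B k)) : ℝ)) / 2) i (hB i)]
    ext v
    congr 1
    ext _
    refine Finset.prod_congr rfl fun k _ => ?_
    by_cases hk : k = i
    · subst hk
      simp only [Function.update_self, if_neg hl.1, sgn_sub_sgn_sub_one, List.mem_cons, true_or,
        if_true]
    · simp [hk]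

theorem mem_parallelepiped_iff (B : Basis (Fin n) ℝ V) (v : V) :
    v ∈ parallelepiped B ↔ ∀ i, 0 ≤ B.repr v i ∧ B.repr v i < 1 := by
  constructor
  · rintro ⟨a, ha, rfl⟩ i
    rw [B.repr_sum_self]
    exact ha i
  · exact fun h => ⟨_, h, (B.sum_repr v).symm⟩

/-- The generating function of the lattice points of a simplicial cone. -/
theorem hasGenFun_flippedCone (M : Submodule ℤ V) {ζ : Dual ℝ V} {B : Basis (Fin n) ℝ V} {α : V}
    (hα : α ∈ M) (hB : ∀ i, B i ∈ M) (hζ : ∀ i, ζ (B i) ≠ 0)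
    (hQ : (parallelepiped B ∩ (M : Set V)).Finite) :
    HasGenFun n ζ (fun v => (M : Set V).indicator (fun _ => flippedCone ζ B (v - α)) v)
      (C (∏ i, ζ (B i))⁻¹ * ((∑ q ∈ hQ.toFinset, expNeg (ζ (α + q))) *
        ∏ i, toddAt (ζ (B i)))) := by
  classical
  refine ⟨(List.finRange n).map B, ?_, ∑ q ∈ hQ.toFinset, Finsupp.single (α + q) 1, ?_, ?_⟩
  · intro u hu
    obtain ⟨i, -, rfl⟩ := List.mem_map.1 hu
    exact hζ i
  · rw [diffs_flippedCone M ζ B α hB _ (List.nodup_finRange n)]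
    ext v
    have h1 : (∑ q ∈ hQ.toFinset, Finsupp.single (α + q) (1 : ℝ)) v =
        if v - α ∈ hQ.toFinset then 1 else 0 := by
      rw [Finsupp.finsetSum_apply,
        ← Finset.sum_ite_eq' hQ.toFinset (v - α) fun _ => (1 : ℝ)]
      refine Finset.sum_congr rfl fun q _ => ?_
      rw [Finsupp.single_apply]
      exact if_congr eq_sub_iff_add_eq'.symm rfl rfl
    rw [h1]
    simp only [List.mem_finRange, if_true, hQ.mem_toFinset, Set.mem_inter_iff,
      mem_parallelepiped_iff]
    by_cases hv : v ∈ M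
    · have hv' : v - α ∈ (M : Set V) := M.sub_mem hv hα
      rw [Set.indicator_of_mem hv, Finset.prod_ite_zero]
      simp [hv']
    · have hv' : v - α ∉ (M : Set V) := fun h => hv (by simpa using M.add_mem h hα)
      rw [Set.indicator_of_notMem hv, if_neg fun h => hv' h.2]
  · have h1 : denom ζ ((List.finRange n).map B) = ∏ i, (1 - expNeg (ζ (B i))) := by
      rw [denom, List.map_map, ← List.ofFn_eq_map, List.prod_ofFn]
      rfl
    have h2 : (∏ i, (1 - expNeg (ζ (B i)))) * ∏ i, toddAt (ζ (B i)) =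
        C (∏ i, ζ (B i)) * X ^ n := by
      rw [← Finset.prod_mul_distrib, Finset.prod_congr rfl fun i _ => one_sub_expNeg_mul_toddAt _,
        Finset.prod_mul_distrib, map_prod]
      simp
    have h3 : (C (∏ i, ζ (B i))⁻¹ * C (∏ i, ζ (B i)) : PowerSeries ℝ) = 1 := by
      rw [← map_mul, inv_mul_cancel₀ (Finset.prod_ne_zero_iff.2 fun i _ => hζ i), map_one]
    rw [genFun_sum_single, h1]
    -- `h2` trades the denominators against the Todd factors, and `h3` cancels the product of the
    -- values of `ζ`.
    linear_combination (-(C (∏ i, ζ (B i))⁻¹ * ∑ q ∈ hQ.toFinset, expNeg (ζ (α + q)))) * h2 -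
      (X ^ n * ∑ q ∈ hQ.toFinset, expNeg (ζ (α + q))) * h3

end Cones

end LatticePolytope

/-! ### From lattice polytopes to bases at vertices, and the lattice point count. -/

namespace LatticePolytope

open Module PowerSeries

variable {V : Type*} [NormedAddCommGroup V] [NormedSpace ℝ V] {n : ℕ} {P : Set V}

theorem IsConvexPolytope.convex (h : IsConvexPolytope P) : Convex ℝ P := by
  obtain ⟨-, H, -, rfl⟩ := h
  intro x hx y hy r s hr hs hrs a ha
  have h1 := mul_le_mul_of_nonneg_left (hx a ha) hr
  have h2 := mul_le_mul_of_nonneg_left (hy a ha) hs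
  rw [map_add, map_smul, map_smul, smul_eq_mul, smul_eq_mul]
  calc a.2 = r * a.2 + s * a.2 := by rw [← add_mul, hrs, one_mul]
    _ ≤ _ := add_le_add h1 h2

theorem IsConvexPolytope.isCompact [FiniteDimensional ℝ V] (h : IsConvexPolytope P) :
    IsCompact P := by
  have := FiniteDimensional.proper_real V
  refine Metric.isCompact_of_isClosed_isBounded ?_ h.1
  obtain ⟨-, H, -, rfl⟩ := h
  simp only [Set.ofPred_forall]
  exact isClosed_biInter fun a _ =>
    isClosed_le continuous_const a.1.continuous_of_finiteDimensional

theorem finite_inter_of_isBounded [FiniteDimensional ℝ V] (M : Submodule ℤ V) [DiscreteTopology M]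
    {s : Set V} (hs : Bornology.IsBounded s) : (s ∩ (M : Set V)).Finite := by
  have := FiniteDimensional.proper_real V
  have : DiscreteTopology M.toAddSubgroup := (inferInstance : DiscreteTopology M)
  exact Metric.finite_isBounded_inter_isClosed DiscreteTopology.isDiscrete hs
    (AddSubgroup.isClosed_of_discrete (H := M.toAddSubgroup))

theorem isBounded_parallelepiped (l : Fin n → V) : Bornology.IsBounded (parallelepiped l) := by
  refine (Metric.isBounded_closedBall (x := (0 : V)) (r := ∑ i, ‖l i‖)).subset ?_
  rintro _ ⟨a, ha, rfl⟩
  rw [mem_closedBall_zero_iff]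
  refine norm_sum_le_of_le _ fun i _ => ?_
  rw [norm_smul, Real.norm_of_nonneg (ha i).1]
  exact mul_le_of_le_one_left (norm_nonneg _) (ha i).2.le

theorem repr_nonneg_of_mem_hull (B : Basis (Fin n) ℝ V) {v : V}
    (hv : v ∈ PointedCone.hull ℝ (Set.range B)) (i : Fin n) : 0 ≤ B.repr v i := by
  obtain ⟨c, rfl⟩ := (Submodule.mem_span_range_iff_exists_fun _).1 hv
  have : ∑ i, c i • B i = ∑ i, (c i : ℝ) • B i := rfl
  rw [this, B.repr_sum_self]
  exact (c i).2

theorem IsSimpleLatticePolytope.isSimpleWithBases [FiniteDimensional ℝ V] {M : Submodule ℤ V}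
    [DiscreteTopology M] (hP : IsSimpleLatticePolytope M P) {b : V → Basis (Fin n) ℝ V}
    (hb : ∀ α ∈ P.extremePoints ℝ,
      tangentCone P α = (PointedCone.hull ℝ (Set.range (b α)) : Set V)) :
    IsSimpleWithBases P b where
  compact := hP.polytope.isCompact
  convex := hP.polytope.convex
  nonempty := by
    rw [Set.nonempty_iff_ne_empty]
    rintro rfl
    exact AffineSubspace.bot_ne_top ℝ V V ((AffineSubspace.span_empty ℝ V V).symm.trans hP.full_dim)
  finite := (finite_inter_of_isBounded M hP.polytope.1).subset fun α hα => ⟨hα.1, hP.lattice α hα⟩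
  repr_nonneg α hα v hv := by
    refine repr_nonneg_of_mem_hull (b α) ?_
    rw [← SetLike.mem_coe, ← hb α hα]
    exact ⟨1, zero_le_one, v, hv, (one_smul ℝ _).symm⟩
  exists_edge α hα i := by
    have h1 : b α i ∈ tangentCone P α := by
      rw [hb α hα]
      exact PointedCone.subset_hull (Set.mem_range_self i)
    obtain ⟨r, hr, v, hv, e⟩ := h1
    have hr0 : r ≠ 0 := by
      rintro rfl
      exact (b α).ne_zero i (by rw [e, zero_smul])
    refine ⟨r⁻¹, inv_pos.2 (lt_of_le_of_ne hr hr0.symm), ?_⟩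
    rwa [e, smul_smul, inv_mul_cancel₀ hr0, one_smul, add_sub_cancel]

end LatticePolytope

open LatticePolytope in
theorem mainTheorem3 {V : Type*} [NormedAddCommGroup V] [NormedSpace ℝ V] [FiniteDimensional ℝ V]
    (n : ℕ) (hn : Module.finrank ℝ V = n)
    (M : Submodule ℤ V) [DiscreteTopology M] [IsZLattice ℝ M]
    (P : Set V) (hP : LatticePolytope.IsSimpleLatticePolytope M P)
    (l : V → Fin n → V)
    (hl : ∀ α ∈ P.extremePoints ℝ,
      LatticePolytope.IsPrimitiveGenerators M (LatticePolytope.tangentCone P α) (l α))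
    (ζ : Module.Dual ℝ V)
    (hζ : ∀ α ∈ P.extremePoints ℝ, ∀ i, ζ (l α i) ≠ 0) :
    ((P ∩ (M : Set V)).ncard : ℝ) =
      ∑ᶠ α ∈ P.extremePoints ℝ,
        (∏ i, ζ (l α i))⁻¹ *
          ∑ j ∈ Finset.range (n + 1),
            ((-1 : ℝ) ^ j / (j.factorial : ℝ)) *
              ∑ᶠ q ∈ LatticePolytope.parallelepiped (l α) ∩ (M : Set V),
                ζ (α + q) ^ j *
                  MvPolynomial.aeval (fun i => ζ (l α i))
                    (LatticePolytope.toddPolynomial n (n - j)) := by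
  classical
  -- Away from the extreme points the basis is an arbitrary default.
  have hex : ∀ α, ∃ B : Module.Basis (Fin n) ℝ V, α ∈ P.extremePoints ℝ → ⇑B = l α := by
    intro α
    by_cases hα : α ∈ P.extremePoints ℝ
    · have hli := (hl α hα).linearIndependent
      exact ⟨Module.Basis.mk hli
        (hli.span_eq_top_of_card_eq_finrank' (by rw [Fintype.card_fin, hn])).ge,
        fun _ => Module.Basis.coe_mk _ _⟩
    · exact ⟨Module.finBasisOfFinrankEq ℝ V hn, fun h => absurd h hα⟩
  choose b hb using hex
  have hS : IsSimpleWithBases P b :=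
    hP.isSimpleWithBases fun α hα => by rw [hb α hα]; exact (hl α hα).generates
  have hζb : ∀ α ∈ P.extremePoints ℝ, ∀ i, ζ (b α i) ≠ 0 := fun α hα i => by
    rw [hb α hα]; exact hζ α hα i
  have hPM := finite_inter_of_isBounded M hP.polytope.1
  have hQ : ∀ α, (LatticePolytope.parallelepiped (b α) ∩ (M : Set V)).Finite :=
    fun α => finite_inter_of_isBounded M (isBounded_parallelepiped _)
  have hsum := HasGenFun.sum (n := n) (ζ := ζ) hS.finite.toFinset fun α hα =>
    have hα := hS.finite.mem_toFinset.1 hα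
    hasGenFun_flippedCone M (B := b α) (hP.lattice α hα)
      (fun i => by rw [hb α hα]; exact ((hl α hα).primitive i).1) (hζb α hα) (hQ α)
  have hF : (∑ α ∈ hS.finite.toFinset,
      fun v => (M : Set V).indicator (fun _ => flippedCone ζ (b α) (v - α)) v) =
      ⇑(∑ m ∈ hPM.toFinset, Finsupp.single m (1 : ℝ)) := by
    ext v
    rw [Finset.sum_apply, Finsupp.finsetSum_apply]
    simp only [Finsupp.single_apply, Finset.sum_ite_eq', hPM.mem_toFinset]
    by_cases hv : v ∈ (M : Set V)
    · simp only [Set.indicator_of_mem hv]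
      rw [hS.sum_flippedCone hζb, Set.indicator_apply]
      simp only [Set.mem_inter_iff, hv, and_true]
    · simp only [Set.indicator_of_notMem hv, Finset.sum_const_zero]
      rw [if_neg fun h => hv h.2]
  rw [hF] at hsum
  -- On the polytope side, this coefficient adds the constant terms of the exponentials, one for
  -- each lattice point.
  have key := congrArg (PowerSeries.coeff n) ((hasGenFun_coe n ζ _).unique hsum)
  rw [genFun_sum_single, coeff_X_pow_mul_sum_expNeg, map_sum] at key
  rw [Set.ncard_eq_toFinset_card _ hPM, key, finsum_mem_eq_finite_toFinset_sum _ hS.finite]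
  refine Finset.sum_congr rfl fun α hα => ?_
  rw [coeff_sum_expNeg_mul_prod_toddAt, ← hb α (hS.finite.mem_toFinset.1 hα)]
  congr 1
  refine Finset.sum_congr rfl fun j _ => ?_
  rw [finsum_mem_eq_finite_toFinset_sum _ (hQ α)]
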